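/- There exist universal constants $c>0$ and $C>0$ such that the following holds. Let $n$ be a natural number, let $a\in\mathbb{R}^n$ satisfy $\|a\|_2=\big(\sum_i a_i^2\big)^{1/2}=1$, and let $l(x)=\sum_{i=1}^n a_i x_i$ for $x\in\{-1,1\}^n$. Let $m\ge\max_i|a_i|$ and $t\ge -m$ be real numbers, and put $\epsilon=\min\big(\tfrac12,\Pr[l(x)>t]\big)$, where $x$ is uniformly distributed in $\{-1,1\}^n$. Then $$c\,\epsilon\,\min\big(1,\,m\sqrt{\log(1/\epsilon)}\big)\;\le\;\Pr\big[l(x)\in(t,t+2m]\big]\;\le\;C\,\epsilon\,\min\big(1,\,m\sqrt{\log(1/\epsilon)}\big),$$ where $\log$ is the natural logarithm, and for $\epsilon=0$ the expression $\epsilon\min\big(1,m\sqrt{\log(1/\epsilon)}\big)$ is read as $0$. That is, $\Pr[l(x)\in(t,t+2m]]=\Theta\big(\epsilon\min(1,m\sqrt{\log(1/\epsilon)})\big)$ with universal implied constants. -/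

import Mathlib

/-- The discrete cube `{-1, 1} ^ n`. The units of `ℤ` are exactly `1` and `-1`. -/
abbrev SignCube (n : ℕ) : Type := Fin n → ℤˣ

open Classical in
/-- The probability of the event `P` when `x` is drawn uniformly at random from `{-1, 1} ^ n`:
the number of points satisfying `P` divided by the number of all points. -/
noncomputable def cubeProb {n : ℕ} (P : SignCube n → Prop) : ℝ :=
  ((Finset.univ.filter P).card : ℝ) / (Fintype.card (SignCube n) : ℝ)

/-- The linear form `l(x) = ∑ i, a i * x i` on the cube. -/
noncomputable def linForm {n : ℕ} (a : EuclideanSpace ℝ (Fin n)) (x : SignCube n) : ℝ :=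
  ∑ i, a i * ((x i : ℤ) : ℝ)

/-!
Write `F s = Pr[l > s]` and `r = √log (1 / ε)`. Both bounds rest on one identity. For a function `φ`
of one variable, averaging over the flip of each sign gives
`𝔼 l φ(l) = ∑ i, 𝔼 w i * (φ(l) - φ(l - 2 * w i)) / 2` with `w i = a i * x i`
(`expect_linForm_mul`). If `φ` is the truncation to `[u, v]`, then, since `∑ i, a i ^ 2 = 1`, the
right side is at most `2 F(u)` and at least `Pr[u + 2 m < l ≤ v - 2 m]`.

Lower bound. The first estimate, with `[u, v] = [t, t + K]` and `t ≥ 0`, gives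
`K (t + K) F(t + K) ≤ 2 F(t)`, so the tail halves over a distance of order `1 / max 1 t`
(`cubeProb_tail_decay`). Reflection of a prefix of the signs, in the manner of the reflection
principle for random walks, shows that intervals further out are not much more likely than
`(t, t + 4 m]`, and an additional flipping argument for the coordinates larger than `m / 2` replaces
`4 m` by `2 m` (`cubeProb_tail_sub_le`). Hence `(t, t + 2 m]` carries a share of order
`min 1 (m * max 1 t)` of `F(t)`. Finally `max 1 t` is at least of order `r` when `m * max 1 t` is
small, by a Gaussian lower bound for the tail (`exp_le_cubeProb_tail`).

Upper bound. This is trivial unless `m * r` is small. Sub-Gaussianity of `l` gives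
`𝔼 l φ(l) ≤ 3 (v - u) r F(u)` when `F(u) ≥ ε`, and the second estimate, with
`[u, v] = [s - 2 m, s + 4 m]`, yields `F(s) - F(s + 2 m) ≤ 18 m r F(s - 2 m)` for all `s ≤ t`. If
`F(t - 2 m)` exceeded `2 F(t)`, this inequality would force `F` to double with every further step of
`2 m` to the left, which is impossible for a function bounded by `1`; so `F(t - 2 m) ≤ 2 F(t)`, and
the inequality for `s = t` is the claim (`cubeProb_Ioc_le_of_exp_le`).
-/

open Finset
open scoped BigOperators

variable {n : ℕ}

/-! ### Expectations on the cube and sign flips -/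

open Classical in
theorem cubeProb_eq_expect (P : SignCube n → Prop) :
    cubeProb P = 𝔼 x, if P x then (1 : ℝ) else 0 := by
  simp [cubeProb, Fintype.expect_eq_sum_div_card]

theorem cubeProb_nonneg (P : SignCube n → Prop) : 0 ≤ cubeProb P := by
  unfold cubeProb; positivity

theorem cubeProb_mono {P Q : SignCube n → Prop} (h : ∀ x, P x → Q x) :
    cubeProb P ≤ cubeProb Q := by
  classical
  unfold cubeProb
  gcongr
  exact h _

theorem cubeProb_le_one (P : SignCube n → Prop) : cubeProb P ≤ 1 := by
  classical
  unfold cubeProb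
  exact div_le_one_of_le₀ (by exact_mod_cast Finset.card_filter_le _ _) (by positivity)

theorem cubeProb_or_le (P Q : SignCube n → Prop) :
    cubeProb (fun x => P x ∨ Q x) ≤ cubeProb P + cubeProb Q := by
  classical
  simp only [cubeProb_eq_expect, ← Finset.expect_add_distrib]
  refine Finset.expect_le_expect fun x _ => ?_
  by_cases hP : P x <;> by_cases hQ : Q x <;> simp [hP, hQ]

/-- The event `u < l ≤ v` is the difference of two nested upper tails. -/
theorem cubeProb_Ioc (a : EuclideanSpace ℝ (Fin n)) {u v : ℝ} (huv : u ≤ v) :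
    cubeProb (fun x => linForm a x ∈ Set.Ioc u v) =
      cubeProb (fun x => u < linForm a x) - cubeProb (fun x => v < linForm a x) := by
  classical
  simp only [cubeProb_eq_expect, ← Finset.expect_sub_distrib]
  refine Finset.expect_congr rfl fun x _ => ?_
  simp only [Set.mem_Ioc]
  by_cases h1 : u < linForm a x <;> by_cases h2 : v < linForm a x
  · simp [h1, h2]
  · simp [h1, h2, not_lt.1 h2]
  · exact absurd (huv.trans_lt h2) h1
  · simp [h1, h2]

/-- The involution of the cube that changes the signs of the coordinates in `J`. -/
def flipOn (J : Finset (Fin n)) (x : SignCube n) : SignCube n :=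
  fun i => if i ∈ J then -x i else x i

theorem flipOn_involutive (J : Finset (Fin n)) : Function.Involutive (flipOn J) := by
  intro x
  funext i
  by_cases h : i ∈ J <;> simp [flipOn, h]

theorem linForm_flipOn (a : EuclideanSpace ℝ (Fin n)) (J : Finset (Fin n)) (x : SignCube n) :
    linForm a (flipOn J x) = linForm a x - 2 * ∑ i ∈ J, a i * ((x i : ℤ) : ℝ) := by
  classical
  have h : ∑ i ∈ J, a i * ((x i : ℤ) : ℝ) = ∑ i, if i ∈ J then a i * ((x i : ℤ) : ℝ) else 0 := by
    simp
  rw [h, linForm, linForm, mul_sum, ← sum_sub_distrib]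
  refine sum_congr rfl fun i _ => ?_
  by_cases hi : i ∈ J
  · simp [flipOn, hi]; ring
  · simp [flipOn, hi]

theorem linForm_flipOn_singleton (a : EuclideanSpace ℝ (Fin n)) (i : Fin n) (x : SignCube n) :
    linForm a (flipOn {i} x) = linForm a x - 2 * (a i * ((x i : ℤ) : ℝ)) := by
  simp [linForm_flipOn]

theorem expect_comp_flipOn (J : Finset (Fin n)) (f : SignCube n → ℝ) :
    𝔼 x, f (flipOn J x) = 𝔼 x, f x :=
  Fintype.expect_equiv (flipOn_involutive J).toPerm _ _ fun _ => rfl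

theorem abs_mul_units (r : ℝ) (s : ℤˣ) : |r * ((s : ℤ) : ℝ)| = |r| := by
  rcases Int.units_eq_one_or s with rfl | rfl <;> simp

theorem sq_mul_units (r : ℝ) (s : ℤˣ) : (r * ((s : ℤ) : ℝ)) ^ 2 = r ^ 2 := by
  rw [← sq_abs, abs_mul_units, sq_abs]

/-! ### A covariance identity for truncations of the linear form -/

/-- Averaging each term of `l` with its flip in one coordinate turns `𝔼 l φ(l)` into a sum of
discrete derivatives of `φ`. -/
theorem expect_linForm_mul (a : EuclideanSpace ℝ (Fin n)) (φ : ℝ → ℝ) :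
    𝔼 x, linForm a x * φ (linForm a x) =
      ∑ i, 𝔼 x : SignCube n, a i * ((x i : ℤ) : ℝ) *
        (φ (linForm a x) - φ (linForm a x - 2 * (a i * ((x i : ℤ) : ℝ)))) / 2 := by
  have h1 : 𝔼 x, linForm a x * φ (linForm a x) =
      ∑ i, 𝔼 x : SignCube n, a i * ((x i : ℤ) : ℝ) * φ (linForm a x) := by
    rw [← Finset.expect_sum_comm]
    refine expect_congr rfl fun x _ => ?_
    conv_lhs => rw [linForm, sum_mul]
    rfl
  rw [h1]
  refine sum_congr rfl fun i _ => ?_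
  have h2 := expect_comp_flipOn {i} fun x => a i * ((x i : ℤ) : ℝ) * φ (linForm a x)
  simp only [linForm_flipOn_singleton] at h2
  have h3 : ∀ x : SignCube n, ((flipOn {i} x i : ℤˣ) : ℤ) = -(x i : ℤ) := by
    intro x; simp [flipOn]
  simp only [h3, Int.cast_neg] at h2
  have h4 : 𝔼 x : SignCube n, a i * ((x i : ℤ) : ℝ) *
        (φ (linForm a x) - φ (linForm a x - 2 * (a i * ((x i : ℤ) : ℝ)))) / 2 =
      (𝔼 x : SignCube n, a i * ((x i : ℤ) : ℝ) * φ (linForm a x)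
        + 𝔼 x : SignCube n, a i * -((x i : ℤ) : ℝ) *
          φ (linForm a x - 2 * (a i * ((x i : ℤ) : ℝ)))) / 2 := by
    rw [← expect_add_distrib, Finset.expect_div]
    refine expect_congr rfl fun x _ => ?_
    ring
  rw [h4, h2]; ring

/-- The truncation of the real line to `[u, v]`, translated so that it vanishes below `u`. -/
noncomputable def truncation (u v y : ℝ) : ℝ := min (max y u) v - u

theorem truncation_of_le {u v y : ℝ} (huv : u ≤ v) (hy : y ≤ u) : truncation u v y = 0 := by
  simp [truncation, max_eq_right hy, huv]

theorem truncation_of_ge {u v y : ℝ} (huv : u ≤ v) (hy : v ≤ y) :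
    truncation u v y = v - u := by
  simp [truncation, max_eq_left (huv.trans hy), hy]

theorem truncation_of_mem {u v y : ℝ} (h1 : u ≤ y) (h2 : y ≤ v) :
    truncation u v y = y - u := by
  simp [truncation, h1, h2]

theorem truncation_nonneg {u v : ℝ} (huv : u ≤ v) (y : ℝ) : 0 ≤ truncation u v y := by
  simp [truncation, huv]

theorem truncation_le {u v : ℝ} (y : ℝ) : truncation u v y ≤ v - u := by
  simp [truncation]

theorem truncation_mono (u v : ℝ) : Monotone (truncation u v) := by
  intro y z h
  unfold truncation
  gcongr

theorem truncation_sub_le {u v y z : ℝ} (h : y ≤ z) :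
    truncation u v z - truncation u v y ≤ z - y := by
  unfold truncation
  rcases le_total z u with h1 | h1 <;> rcases le_total y u with h2 | h2 <;>
    simp only [h1, h2, max_eq_left, max_eq_right] <;> grind

theorem mul_truncation_sub_nonneg (u v y w : ℝ) :
    0 ≤ w * (truncation u v y - truncation u v (y - 2 * w)) := by
  rcases le_total 0 w with hw | hw
  · exact mul_nonneg hw (sub_nonneg.2 (truncation_mono u v (by linarith)))
  · exact mul_nonneg_of_nonpos_of_nonpos hw (sub_nonpos.2 (truncation_mono u v (by linarith)))

theorem mul_truncation_sub_le (u v y w : ℝ) :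
    w * (truncation u v y - truncation u v (y - 2 * w)) ≤ 2 * w ^ 2 := by
  rcases le_total 0 w with hw | hw
  · have := truncation_sub_le (u := u) (v := v) (y := y - 2 * w) (z := y) (by linarith)
    nlinarith
  · have := truncation_sub_le (u := u) (v := v) (y := y) (z := y - 2 * w) (by linarith)
    nlinarith

theorem sum_sq_eq_one {a : EuclideanSpace ℝ (Fin n)} (ha : ‖a‖ = 1) : ∑ i, a i ^ 2 = 1 := by
  rw [← EuclideanSpace.real_norm_sq_eq, ha, one_pow]

/-- Every discrete derivative of the truncation at `l` is at most the step, and vanishes if both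
end points are at most `u`. -/
theorem expect_linForm_mul_truncation_le {a : EuclideanSpace ℝ (Fin n)} (ha : ‖a‖ = 1)
    {u v : ℝ} (huv : u ≤ v) :
    𝔼 x, linForm a x * truncation u v (linForm a x) ≤
      2 * cubeProb (fun x => u < linForm a x) := by
  classical
  rw [expect_linForm_mul]
  calc _ ≤ ∑ i, a i ^ 2 * (2 * cubeProb (fun x => u < linForm a x)) := by
        refine sum_le_sum fun i _ => ?_
        have h := expect_comp_flipOn {i} fun x => if u < linForm a x then (1 : ℝ) else 0
        simp only [linForm_flipOn_singleton] at h
        rw [two_mul, cubeProb_eq_expect]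
        nth_rewrite 2 [← h]
        rw [← expect_add_distrib, mul_expect]
        refine expect_le_expect fun x _ => ?_
        have h1 := mul_truncation_sub_le u v (linForm a x) (a i * ((x i : ℤ) : ℝ))
        have h2 := sq_mul_units (a i) (x i)
        have h3 := sq_nonneg (a i)
        split_ifs with h4 h5 h5
        · linarith
        · linarith
        · linarith
        · rw [truncation_of_le huv (not_lt.1 h4), truncation_of_le huv (not_lt.1 h5)]
          simp
    _ = _ := by rw [← sum_mul, sum_sq_eq_one ha, one_mul]

/-- Within `[u + 2 m, v - 2 m]` a flip of one sign does not leave `[u, v]`, where the truncation has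
slope one. -/
theorem cubeProb_Ioc_le_expect {a : EuclideanSpace ℝ (Fin n)} (ha : ‖a‖ = 1) {m : ℝ}
    (hm : ∀ i, |a i| ≤ m) (u v : ℝ) :
    cubeProb (fun x => linForm a x ∈ Set.Ioc (u + 2 * m) (v - 2 * m)) ≤
      𝔼 x, linForm a x * truncation u v (linForm a x) := by
  classical
  rw [expect_linForm_mul]
  calc _ = ∑ i, a i ^ 2 *
        cubeProb (fun x => linForm a x ∈ Set.Ioc (u + 2 * m) (v - 2 * m)) := by
        rw [← sum_mul, sum_sq_eq_one ha, one_mul]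
    _ ≤ _ := by
        refine sum_le_sum fun i _ => ?_
        rw [cubeProb_eq_expect, mul_expect]
        refine expect_le_expect fun x _ => ?_
        have h1 := mul_truncation_sub_nonneg u v (linForm a x) (a i * ((x i : ℤ) : ℝ))
        have h2 := sq_mul_units (a i) (x i)
        have h3 := abs_mul_units (a i) (x i)
        have h4 := abs_le.1 (h3.trans_le (hm i))
        have hm0 := (abs_nonneg _).trans (hm i)
        split_ifs with h
        · obtain ⟨h5, h6⟩ := h
          rw [truncation_of_mem (by linarith) (by linarith),
            truncation_of_mem (by linarith) (by linarith)]
          nlinarith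
        · linarith

/-- With `K = 4 / max 1 t` the factor on the left is at least `4`: the tail at `t` at least halves
over a distance of order `1 / max 1 t`. -/
theorem cubeProb_tail_decay {a : EuclideanSpace ℝ (Fin n)} (ha : ‖a‖ = 1) {t K : ℝ}
    (ht : 0 ≤ t) (hK : 0 ≤ K) :
    K * (t + K) * cubeProb (fun x => t + K < linForm a x) ≤
      2 * cubeProb (fun x => t < linForm a x) := by
  classical
  refine le_trans ?_ (expect_linForm_mul_truncation_le ha (show t ≤ t + K by linarith))
  rw [cubeProb_eq_expect, mul_expect]
  refine expect_le_expect fun x _ => ?_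
  split_ifs with h
  · rw [truncation_of_ge (by linarith) h.le]
    nlinarith
  · rcases le_total (linForm a x) t with h1 | h1
    · rw [truncation_of_le (by linarith) h1]; simp
    · have := truncation_nonneg (show t ≤ t + K by linarith) (linForm a x)
      have : 0 ≤ linForm a x := by linarith
      rw [mul_zero]; positivity

/-! ### Reflection and flipping -/

theorem cubeProb_le_mul_of_card_le {P Q : SignCube n → Prop} {r : ℝ}
    (h : ∀ A B : Finset (SignCube n), (∀ x, x ∈ A ↔ P x) → (∀ x, x ∈ B ↔ Q x) →
      (#A : ℝ) ≤ r * #B) :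
    cubeProb P ≤ r * cubeProb Q := by
  classical
  unfold cubeProb
  rw [← mul_div_assoc]
  gcongr
  exact h _ _ (fun x => by simp) (fun x => by simp)

/-- Twice the sum of the terms of `l` with index in `J` and less than `k`: the amount by which `l`
decreases when these signs are flipped. -/
noncomputable def prefixSum (a : EuclideanSpace ℝ (Fin n)) (J : Finset (Fin n)) (x : SignCube n)
    (k : ℕ) : ℝ :=
  2 * ∑ i ∈ J with i.val < k, a i * ((x i : ℤ) : ℝ)

theorem prefixSum_zero (a : EuclideanSpace ℝ (Fin n)) (J : Finset (Fin n)) (x : SignCube n) :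
    prefixSum a J x 0 = 0 := by
  simp [prefixSum]

theorem prefixSum_succ_le {a : EuclideanSpace ℝ (Fin n)} {J : Finset (Fin n)} {b : ℝ}
    (hb : 0 ≤ b) (hJ : ∀ i ∈ J, |a i| ≤ b) (x : SignCube n) (k : ℕ) :
    prefixSum a J x (k + 1) ≤ prefixSum a J x k + 2 * b := by
  by_cases hk : ∃ i ∈ J, i.val = k
  · obtain ⟨i, hi, rfl⟩ := hk
    have : {j ∈ J | j.val < i.val + 1} = insert i {j ∈ J | j.val < i.val} := by
      ext j
      simp only [mem_filter, mem_insert]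
      constructor
      · rintro ⟨h1, h2⟩
        rcases Nat.lt_succ_iff_lt_or_eq.1 h2 with h | h
        · exact Or.inr ⟨h1, h⟩
        · exact Or.inl (Fin.ext h)
      · rintro (rfl | ⟨h1, h2⟩)
        · exact ⟨hi, Nat.lt_succ_self _⟩
        · exact ⟨h1, h2.trans (Nat.lt_succ_self _)⟩
    rw [prefixSum, prefixSum, this, sum_insert (by simp)]
    have := (le_abs_self _).trans ((abs_mul_units (a i) (x i)).trans_le (hJ i hi))
    linarith
  · have : {j ∈ J | j.val < k + 1} = {j ∈ J | j.val < k} := by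
      refine filter_congr fun j hj => ?_
      have : j.val ≠ k := fun h => hk ⟨j, hj, h⟩
      omega
    rw [prefixSum, prefixSum, this]
    linarith

theorem prefixSum_flipOn (a : EuclideanSpace ℝ (Fin n)) (J : Finset (Fin n)) (x : SignCube n)
    {j k : ℕ} (hjk : j ≤ k) :
    prefixSum a J (flipOn {i ∈ J | i.val < k} x) j = -prefixSum a J x j := by
  rw [prefixSum, prefixSum, ← mul_neg, ← sum_neg_distrib]
  congr 1
  refine sum_congr rfl fun i hi => ?_
  obtain ⟨h1, h2⟩ := mem_filter.1 hi
  simp [flipOn, h1, h2.trans_le hjk]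

/-- The reflection principle: flipping the signs in `J` up to the first time at which
`prefixSum` reaches `d` is injective, and lowers `l` by an amount in `[d, d + 2 b]`. -/
theorem cubeProb_reflection {a : EuclideanSpace ℝ (Fin n)} {J : Finset (Fin n)} {b d : ℝ}
    (hb : 0 ≤ b) (hd : 0 ≤ d) (hJ : ∀ i ∈ J, |a i| ≤ b) (u v : ℝ) :
    cubeProb (fun x => linForm a x ∈ Set.Ioc u v ∧ d ≤ 2 * ∑ i ∈ J, a i * ((x i : ℤ) : ℝ)) ≤
      cubeProb (fun x => linForm a x ∈ Set.Ioc (u - d - 2 * b) (v - d)) := by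
  classical
  refine le_of_le_of_eq ?_ (one_mul _)
  refine cubeProb_le_mul_of_card_le fun A B hA hB => ?_
  rw [one_mul, Nat.cast_le]
  have hex : ∀ x ∈ A, ∃ k, d ≤ prefixSum a J x k := by
    intro x hx
    refine ⟨n, ((hA x).1 hx).2.trans_eq ?_⟩
    rw [prefixSum, filter_true_of_mem fun i _ => i.2]
  let κ : SignCube n → ℕ := fun x => if h : ∃ k, d ≤ prefixSum a J x k then Nat.find h else 0
  have hκ : ∀ x ∈ A, d ≤ prefixSum a J x (κ x) := by
    intro x hx
    simp only [κ, dif_pos (hex x hx)]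
    exact Nat.find_spec (hex x hx)
  have hmin : ∀ x k, d ≤ prefixSum a J x k → κ x ≤ k := by
    intro x k hk
    simp only [κ, dif_pos (⟨k, hk⟩ : ∃ k, d ≤ prefixSum a J x k)]
    exact Nat.find_min' _ hk
  have hover : ∀ x, prefixSum a J x (κ x) ≤ d + 2 * b := by
    intro x
    rcases hk : κ x with _ | k
    · rw [prefixSum_zero]; positivity
    · have : prefixSum a J x k < d := by
        by_contra! h
        have := hmin x k h
        omega
      linarith [prefixSum_succ_le hb hJ x k]
  let R : SignCube n → SignCube n := fun x => flipOn {i ∈ J | i.val < κ x} x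
  -- The reflected walk reaches `-d` no later than the original one reaches `d`.
  have hle : ∀ x ∈ A, ∀ y, R x = R y → κ x ≤ κ y → κ y ≤ κ x := by
    intro x hx y hxy hk
    apply hmin
    have h1 := prefixSum_flipOn a J y hk
    have h2 := prefixSum_flipOn a J x (le_refl (κ x))
    change flipOn _ x = flipOn _ y at hxy
    rw [← hxy, h2] at h1
    linarith [hκ x hx]
  refine card_le_card_of_injOn R ?_ ?_
  · intro x hx
    obtain ⟨⟨h1, h2⟩, -⟩ := (hA x).1 hx
    refine (hB _).2 ?_
    have h3 : linForm a (R x) = linForm a x - prefixSum a J x (κ x) := linForm_flipOn a _ x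
    have h4 := hκ x hx
    have h5 := hover x
    rw [h3]
    constructor <;> linarith
  · intro x hx y hy hxy
    have hk : κ x = κ y := by
      rcases le_total (κ x) (κ y) with h | h
      · exact le_antisymm h (hle x hx y hxy h)
      · exact le_antisymm (hle y hy x hxy.symm h) h
    simp only [R, hk] at hxy
    exact (flipOn_involutive _).injective hxy

/-- Double counting of the pairs of a point of `A` and one of its positive coordinates in `I`. -/
theorem card_le_two_mul_card_of_flip {a : EuclideanSpace ℝ (Fin n)} {I : Finset (Fin n)}
    {A B : Finset (SignCube n)}
    (hcard : ∀ x ∈ A, #{i ∈ I | a i * ((x i : ℤ) : ℝ) < 0} + 1 ≤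
      2 * #{i ∈ I | 0 < a i * ((x i : ℤ) : ℝ)})
    (hB : ∀ x ∈ A, ∀ i ∈ I, 0 < a i * ((x i : ℤ) : ℝ) → flipOn {i} x ∈ B) :
    (#A : ℝ) ≤ 2 * #B := by
  classical
  let pos : SignCube n → Finset (Fin n) := fun x => {i ∈ I | 0 < a i * ((x i : ℤ) : ℝ)}
  let neg : SignCube n → Finset (Fin n) := fun x => {i ∈ I | a i * ((x i : ℤ) : ℝ) < 0}
  have hsame : ∀ (x : SignCube n) i, ((flipOn {i} x i : ℤˣ) : ℤ) = -(x i : ℤ) := by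
    intro x i; simp [flipOn]
  have hother : ∀ (x : SignCube n) i j, j ≠ i → flipOn {i} x j = x j := by
    intro x i j h; simp [flipOn, h]
  have hmem : ∀ (x : SignCube n) i, i ∈ pos (flipOn {i} x) ↔ i ∈ neg x := by
    intro x i
    simp only [pos, neg, mem_filter, hsame]
    push_cast
    rw [mul_neg, neg_pos]
  -- Flipping a positive coordinate moves it from `pos` to `neg`.
  have hpos : ∀ x, ∀ i ∈ neg x, #(pos (flipOn {i} x)) = #(pos x) + 1 := by
    intro x i hi
    have : pos (flipOn {i} x) = insert i (pos x) := by
      ext j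
      rcases eq_or_ne j i with rfl | hj
      · simp [hmem, hi]
      · simp [pos, hother x i j hj, hj]
    rw [this, card_insert_of_notMem]
    intro h
    have h1 := (mem_filter.1 h).2
    have h2 := (mem_filter.1 hi).2
    linarith
  have hneg : ∀ x, ∀ i ∈ neg x, #(neg x) = #(neg (flipOn {i} x)) + 1 := by
    intro x i hi
    have : neg x = insert i (neg (flipOn {i} x)) := by
      ext j
      rcases eq_or_ne j i with rfl | hj
      · simp [hi]
      · simp [neg, hother x i j hj, hj]
    rw [this, card_insert_of_notMem]
    intro h
    have h1 := (mem_filter.1 h).2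
    have h2 := (mem_filter.1 hi).2
    rw [hsame] at h1
    push_cast at h1
    linarith
  have key : (#A : ℝ) ≤ ∑ x ∈ B, 2 := by
    calc (#A : ℝ) = ∑ x, ∑ i, if x ∈ A ∧ i ∈ pos x then (1 : ℝ) / #(pos x) else 0 := by
          rw [card_eq_sum_ones, Nat.cast_sum, ← sum_filter_add_sum_filter_not univ (· ∈ A),
            sum_eq_zero (s := {x | x ∉ A}), add_zero]
          · have : ({x | x ∈ A} : Finset (SignCube n)) = A := by ext; simp
            rw [this]
            refine sum_congr rfl fun x hx => ?_
            have h0 : (#(pos x) : ℝ) ≠ 0 := by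
              have := hcard x hx
              have : #(pos x) ≠ 0 := by simp only [pos]; omega
              exact_mod_cast this
            simp only [hx, true_and]
            rw [sum_ite_mem, univ_inter, sum_const, nsmul_eq_mul]
            field_simp
            simp
          · intro x hx
            have : x ∉ A := by simpa using hx
            simp [this]
      _ = ∑ i, ∑ x, if x ∈ A ∧ i ∈ pos x then (1 : ℝ) / #(pos x) else 0 := sum_comm
      _ = ∑ i, ∑ x, if flipOn {i} x ∈ A ∧ i ∈ neg x then (1 : ℝ) / (#(pos x) + 1) else 0 := by
          refine sum_congr rfl fun i _ => ?_
          rw [← Equiv.sum_comp (flipOn_involutive {i}).toPerm]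
          refine sum_congr rfl fun x _ => ?_
          simp only [Function.Involutive.coe_toPerm, hmem]
          by_cases h : i ∈ neg x
          · simp [h, hpos x i h]
          · simp [h]
      _ = ∑ x, ∑ i, if flipOn {i} x ∈ A ∧ i ∈ neg x then (1 : ℝ) / (#(pos x) + 1) else 0 :=
          sum_comm
      _ ≤ ∑ x, if x ∈ B then 2 else 0 := by
          refine sum_le_sum fun x _ => ?_
          by_cases hex : ∃ i, flipOn {i} x ∈ A ∧ i ∈ neg x
          · obtain ⟨i, hiA, hi⟩ := hex
            have hxB : x ∈ B := by
              have h1 := (hmem x i).2 hi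
              have := hB _ hiA i (mem_filter.1 h1).1 (mem_filter.1 h1).2
              rwa [flipOn_involutive] at this
            have h2 : #(neg x) ≤ 2 * (#(pos x) + 1) := by
              have h3 : #(neg (flipOn {i} x)) + 1 ≤ 2 * #(pos (flipOn {i} x)) := hcard _ hiA
              rwa [← hneg x i hi, hpos x i hi] at h3
            rw [if_pos hxB]
            calc _ ≤ ∑ i, if i ∈ neg x then (1 : ℝ) / (#(pos x) + 1) else 0 := by
                  refine sum_le_sum fun j _ => ?_
                  by_cases hj : j ∈ neg x
                  · simp only [hj, and_true, if_true]
                    split_ifs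
                    · exact le_refl _
                    · positivity
                  · simp [hj]
              _ = #(neg x) / (#(pos x) + 1) := by
                  rw [sum_ite_mem, univ_inter, sum_const, nsmul_eq_mul, mul_one_div]
              _ ≤ 2 := by
                  rw [div_le_iff₀ (by positivity)]
                  exact_mod_cast h2
          · rw [sum_eq_zero fun i _ => if_neg fun h => hex ⟨i, h⟩]
            split_ifs <;> norm_num
      _ = ∑ x ∈ B, 2 := by simp
  rw [sum_const, nsmul_eq_mul] at key
  linarith

/-- Coordinates with `|a i| ≤ m / 2` are handled by reflection. If they do not suffice, then the
coordinates with `|a i| > m / 2` have a positive sum, so at least a third of them are positive, and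
flipping any positive one moves `l` into the target interval. -/
theorem cubeProb_Ioc_near_le {a : EuclideanSpace ℝ (Fin n)} {m t : ℝ} (hm0 : 0 < m)
    (hm : ∀ i, |a i| ≤ m) (ht : -m ≤ t) :
    cubeProb (fun x => linForm a x ∈ Set.Ioc (t + 2 * m) (t + 3 * m)) ≤
      3 * cubeProb (fun x => linForm a x ∈ Set.Ioc t (t + 2 * m)) := by
  classical
  let J : Finset (Fin n) := {i | |a i| ≤ m / 2}
  let I : Finset (Fin n) := {i | ¬ |a i| ≤ m / 2}
  have hI : ∀ i ∈ I, m / 2 < |a i| := fun i hi => not_le.1 (mem_filter.1 hi).2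
  have h1 : cubeProb (fun x => linForm a x ∈ Set.Ioc (t + 2 * m) (t + 3 * m) ∧
        m ≤ 2 * ∑ i ∈ J, a i * ((x i : ℤ) : ℝ)) ≤
      cubeProb (fun x => linForm a x ∈ Set.Ioc t (t + 2 * m)) := by
    refine (cubeProb_reflection (J := J) (b := m / 2) (by positivity) hm0.le
      (fun i hi => (mem_filter.1 hi).2) _ _).trans_eq ?_
    rw [show t + 2 * m - m - 2 * (m / 2) = t by ring, show t + 3 * m - m = t + 2 * m by ring]
  have h2 : cubeProb (fun x => linForm a x ∈ Set.Ioc (t + 2 * m) (t + 3 * m) ∧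
        ¬ m ≤ 2 * ∑ i ∈ J, a i * ((x i : ℤ) : ℝ)) ≤
      2 * cubeProb (fun x => linForm a x ∈ Set.Ioc t (t + 2 * m)) := by
    refine cubeProb_le_mul_of_card_le fun A B hA hB => ?_
    refine card_le_two_mul_card_of_flip (a := a) (I := I) ?_ ?_
    · intro x hx
      obtain ⟨⟨hx1, -⟩, hx3⟩ := (hA x).1 hx
      have hsplit : linForm a x = ∑ i ∈ J, a i * ((x i : ℤ) : ℝ) + ∑ i ∈ I, a i * ((x i : ℤ) : ℝ) :=
        (sum_filter_add_sum_filter_not univ _ _).symm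
      have hpos : 0 < ∑ i ∈ I, a i * ((x i : ℤ) : ℝ) := by linarith
      have hle : ∑ i ∈ I, a i * ((x i : ℤ) : ℝ) ≤
          m * #{i ∈ I | 0 < a i * ((x i : ℤ) : ℝ)} -
            m / 2 * #{i ∈ I | a i * ((x i : ℤ) : ℝ) < 0} := by
        rw [card_filter, card_filter]
        push_cast
        rw [mul_sum, mul_sum, ← sum_sub_distrib]
        refine sum_le_sum fun i hi => ?_
        have e := abs_mul_units (a i) (x i)
        have e1 := hI i hi
        have e2 := hm i
        rcases lt_trichotomy (a i * ((x i : ℤ) : ℝ)) 0 with h | h | h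
        · rw [if_neg h.not_gt, if_pos h]
          rw [abs_of_neg h] at e
          linarith
        · rw [h, abs_zero] at e
          linarith
        · rw [if_pos h, if_neg h.not_gt]
          rw [abs_of_pos h] at e
          linarith
      have h3 : (#{i ∈ I | a i * ((x i : ℤ) : ℝ) < 0} : ℝ) <
          2 * #{i ∈ I | 0 < a i * ((x i : ℤ) : ℝ)} := by
        have := hpos.trans_le hle
        by_contra! h
        nlinarith
      exact_mod_cast h3
    · intro x hx i hi hp
      obtain ⟨⟨hx1, hx2⟩, -⟩ := (hA x).1 hx
      refine (hB _).2 ?_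
      rw [linForm_flipOn_singleton]
      have e := abs_mul_units (a i) (x i)
      rw [abs_of_pos hp] at e
      have e1 := hI i hi
      have e2 := hm i
      constructor <;> linarith
  calc _ ≤ _ := cubeProb_mono (fun x hx => by
        by_cases h : m ≤ 2 * ∑ i ∈ J, a i * ((x i : ℤ) : ℝ)
        · exact Or.inl ⟨hx, h⟩
        · exact Or.inr ⟨hx, h⟩)
    _ ≤ _ := (cubeProb_or_le _ _).trans (add_le_add h1 h2)
    _ = _ := by ring

theorem cubeProb_Ioc_far_le {a : EuclideanSpace ℝ (Fin n)} {m s t : ℝ} (hm0 : 0 < m)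
    (hm : ∀ i, |a i| ≤ m) (ht : -m ≤ t) (hs : t + 2 * m ≤ s) :
    cubeProb (fun x => linForm a x ∈ Set.Ioc s (s + 2 * m)) ≤
      cubeProb (fun x => linForm a x ∈ Set.Ioc t (t + 4 * m)) := by
  have h := cubeProb_reflection (a := a) (J := univ) (b := m) (d := s - t - 2 * m) hm0.le
    (by linarith) (fun i _ => hm i) s (s + 2 * m)
  have e1 : s - (s - t - 2 * m) - 2 * m = t := by ring
  have e2 : s + 2 * m - (s - t - 2 * m) = t + 4 * m := by ring
  rw [e1, e2] at h
  refine (cubeProb_mono fun x hx => ⟨hx, ?_⟩).trans h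
  have : s < linForm a x := hx.1
  rw [linForm] at this
  linarith

/-- Up to a constant, the interval of length `2 m` just above `t` is at least as likely as any
interval of length `2 m` further out. -/
theorem cubeProb_tail_sub_le {a : EuclideanSpace ℝ (Fin n)} {m t : ℝ} (hm0 : 0 < m)
    (hm : ∀ i, |a i| ≤ m) (ht : -m ≤ t) (N : ℕ) :
    cubeProb (fun x => t < linForm a x) - cubeProb (fun x => t + N * (2 * m) < linForm a x) ≤
      N * (16 * cubeProb (fun x => linForm a x ∈ Set.Ioc t (t + 2 * m))) := by
  have h4 : cubeProb (fun x => linForm a x ∈ Set.Ioc t (t + 4 * m)) ≤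
      16 * cubeProb (fun x => linForm a x ∈ Set.Ioc t (t + 2 * m)) := by
    have n1 := cubeProb_Ioc_near_le hm0 hm ht
    have n2 := cubeProb_Ioc_near_le hm0 hm (show -m ≤ t + m by linarith)
    rw [show t + m + 2 * m = t + 3 * m by ring, show t + m + 3 * m = t + 4 * m by ring] at n2
    rw [cubeProb_Ioc a (by linarith)] at n1 n2 ⊢
    rw [cubeProb_Ioc a (by linarith)] at n1 n2 ⊢
    have n3 : cubeProb (fun x => t + m < linForm a x) ≤ cubeProb (fun x => t < linForm a x) :=
      cubeProb_mono fun x hx => by linarith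
    linarith
  induction N with
  | zero => simp
  | succ N ih =>
    have hstep : cubeProb (fun x => t + N * (2 * m) < linForm a x) -
        cubeProb (fun x => t + (N + 1 : ℕ) * (2 * m) < linForm a x) ≤
        16 * cubeProb (fun x => linForm a x ∈ Set.Ioc t (t + 2 * m)) := by
      refine le_trans ?_ h4
      have e : t + ((N + 1 : ℕ) : ℝ) * (2 * m) = t + N * (2 * m) + 2 * m := by push_cast; ring
      rw [e, ← cubeProb_Ioc a (by linarith)]
      rcases N with _ | N
      · refine cubeProb_mono fun x hx => ⟨?_, ?_⟩
        · simpa using hx.1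
        · have := hx.2
          simp only [Nat.cast_zero, zero_mul, add_zero] at this
          linarith
      · refine cubeProb_Ioc_far_le hm0 hm ht ?_
        push_cast
        have : 0 ≤ (N : ℝ) * (2 * m) := by positivity
        linarith
    push_cast at hstep ⊢
    linarith

/-! ### Exponential moments -/

theorem expect_exp_linForm (a : EuclideanSpace ℝ (Fin n)) (r : ℝ) :
    𝔼 x, Real.exp (r * linForm a x) = ∏ i, Real.cosh (r * a i) := by
  have h1 : ∀ i, Real.cosh (r * a i) =
      (∑ s : ℤˣ, Real.exp (r * (a i * ((s : ℤ) : ℝ)))) / 2 := by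
    intro i
    rw [Real.cosh_eq, show (univ : Finset ℤˣ) = {1, -1} from rfl, sum_pair (by decide)]
    simp
  simp_rw [h1]
  rw [prod_div_distrib, prod_univ_sum, Fintype.piFinset_univ, Fintype.expect_eq_sum_div_card]
  congr 1
  · refine sum_congr rfl fun x _ => ?_
    rw [← Real.exp_sum, linForm, mul_sum]
  · simp

theorem expect_exp_linForm_le {a : EuclideanSpace ℝ (Fin n)} (ha : ‖a‖ = 1) (r : ℝ) :
    𝔼 x, Real.exp (r * linForm a x) ≤ Real.exp (r ^ 2 / 2) := by
  rw [expect_exp_linForm]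
  calc _ ≤ ∏ i, Real.exp ((r * a i) ^ 2 / 2) :=
        prod_le_prod (fun i _ => (Real.cosh_pos _).le) fun i _ => Real.cosh_le_exp_half_sq _
    _ = _ := by
        rw [← Real.exp_sum, ← sum_div]
        simp_rw [mul_pow]
        rw [← mul_sum, sum_sq_eq_one ha, mul_one]

theorem exp_sq_div_four_le_cosh {y : ℝ} (hy : |y| ≤ 1) : Real.exp (y ^ 2 / 4) ≤ Real.cosh y := by
  have hy2 : y ^ 2 ≤ 1 := (sq_le_one_iff_abs_le_one y).2 hy
  refine (pow_le_pow_iff_left₀ (Real.exp_pos _).le (Real.cosh_pos y).le two_ne_zero).1 ?_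
  have h1 := Real.abs_exp_sub_one_le (x := y ^ 2 / 2)
    (by rw [abs_of_nonneg (by positivity)]; linarith)
  rw [abs_of_nonneg (show 0 ≤ y ^ 2 / 2 by positivity)] at h1
  have h2 := (abs_le.1 h1).2
  have h3 : |y| ≤ Real.sinh |y| := Real.self_le_sinh_iff.2 (abs_nonneg y)
  have h4 : y ^ 2 ≤ Real.sinh y ^ 2 := by
    rw [← sq_abs y, ← sq_abs (Real.sinh y), Real.abs_sinh]
    gcongr
  rw [← Real.exp_nat_mul, Real.cosh_sq]
  calc Real.exp ((2 : ℕ) * (y ^ 2 / 4)) = Real.exp (y ^ 2 / 2) := by congr 1; push_cast; ring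
    _ ≤ _ := by linarith

theorem exp_le_expect_exp_linForm {a : EuclideanSpace ℝ (Fin n)} (ha : ‖a‖ = 1) {m r : ℝ}
    (hm : ∀ i, |a i| ≤ m) (hr : 0 ≤ r) (hrm : r * m ≤ 1) :
    Real.exp (r ^ 2 / 4) ≤ 𝔼 x, Real.exp (r * linForm a x) := by
  rw [expect_exp_linForm]
  calc _ = ∏ i, Real.exp ((r * a i) ^ 2 / 4) := by
        rw [← Real.exp_sum, ← sum_div]
        simp_rw [mul_pow]
        rw [← mul_sum, sum_sq_eq_one ha, mul_one]
    _ ≤ _ := by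
        refine prod_le_prod (fun i _ => (Real.exp_pos _).le) fun i _ => exp_sq_div_four_le_cosh ?_
        rw [abs_mul, abs_of_nonneg hr]
        exact (mul_le_mul_of_nonneg_left (hm i) hr).trans hrm

/-- A Gaussian lower bound for the tail, by the second moment method applied to
`exp (8 s l)`. -/
theorem exp_le_cubeProb_tail {a : EuclideanSpace ℝ (Fin n)} (ha : ‖a‖ = 1) {m s : ℝ}
    (hm : ∀ i, |a i| ≤ m) (hs : 1 ≤ s) (hsm : 8 * s * m ≤ 1) :
    Real.exp (-(98 * s ^ 2)) ≤ cubeProb (fun x => s < linForm a x) := by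
  classical
  set F := cubeProb (fun x => s < linForm a x) with hF
  set f : SignCube n → ℝ := fun x => if s < linForm a x then 1 else 0 with hf
  have hFf : F = 𝔼 x, f x := by rw [hF, cubeProb_eq_expect]
  have h1 : Real.exp (16 * s ^ 2) ≤ 𝔼 x, Real.exp (8 * s * linForm a x) := by
    refine le_trans (le_of_eq ?_) (exp_le_expect_exp_linForm ha hm (by linarith) hsm)
    congr 1; ring
  have h2 : 𝔼 x, Real.exp (8 * s * linForm a x) ≤
      Real.exp (8 * s ^ 2) + 𝔼 x, Real.exp (8 * s * linForm a x) * f x := by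
    have : 𝔼 _x : SignCube n, Real.exp (8 * s ^ 2) = Real.exp (8 * s ^ 2) :=
      Fintype.expect_const _
    rw [← this, ← expect_add_distrib]
    refine expect_le_expect fun x _ => ?_
    by_cases h : s < linForm a x
    · simp only [hf, if_pos h, mul_one]
      linarith [Real.exp_pos (8 * s ^ 2)]
    · simp only [hf, if_neg h, mul_zero, add_zero]
      refine Real.exp_le_exp.2 ?_
      nlinarith [not_lt.1 h]
  have h3 : (𝔼 x, Real.exp (8 * s * linForm a x) * f x) ^ 2 ≤ Real.exp (128 * s ^ 2) * F := by
    refine (expect_mul_sq_le_sq_mul_sq univ _ _).trans ?_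
    have e1 : 𝔼 x, f x ^ 2 = F := by
      rw [hFf]
      refine expect_congr rfl fun x _ => ?_
      simp only [hf]; split_ifs <;> norm_num
    rw [e1]
    refine mul_le_mul_of_nonneg_right ?_ (cubeProb_nonneg _)
    calc _ = 𝔼 x, Real.exp (16 * s * linForm a x) := by
          refine expect_congr rfl fun x _ => ?_
          rw [← Real.exp_nat_mul]
          congr 1; push_cast; ring
      _ ≤ _ := expect_exp_linForm_le ha _
      _ = _ := by congr 1; ring
  have h4 : 2 * Real.exp (8 * s ^ 2) ≤ Real.exp (16 * s ^ 2) := by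
    rw [show 16 * s ^ 2 = 8 * s ^ 2 + 8 * s ^ 2 by ring, Real.exp_add]
    have := Real.add_one_le_exp (8 * s ^ 2)
    have : 2 ≤ Real.exp (8 * s ^ 2) := by nlinarith
    nlinarith [Real.exp_pos (8 * s ^ 2)]
  have h5 : Real.exp (15 * s ^ 2) ≤ Real.exp (16 * s ^ 2) / 2 := by
    rw [show 16 * s ^ 2 = 15 * s ^ 2 + s ^ 2 by ring, Real.exp_add]
    have := Real.add_one_le_exp (s ^ 2)
    have : 2 ≤ Real.exp (s ^ 2) := by nlinarith
    nlinarith [Real.exp_pos (15 * s ^ 2)]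
  have h6 : Real.exp (15 * s ^ 2) ^ 2 ≤ Real.exp (128 * s ^ 2) * F :=
    le_trans (pow_le_pow_left₀ (Real.exp_pos _).le (by linarith) 2) h3
  rw [← Real.exp_nat_mul] at h6
  have h7 : Real.exp (-(98 * s ^ 2)) * Real.exp (128 * s ^ 2) =
      Real.exp ((2 : ℕ) * (15 * s ^ 2)) := by
    rw [← Real.exp_add]
    congr 1; push_cast; ring
  rw [← h7, mul_comm] at h6
  exact le_of_mul_le_mul_left h6 (Real.exp_pos _)

/-- Sub-Gaussianity, in dual form: conditioning on `l > u`, an event of probability at least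
`exp (-r ^ 2)`, moves the mean of `l` by at most a multiple of `r`. The event enters through the
truncation, a weight with values in `[0, v - u]` that vanishes off it. -/
theorem expect_linForm_mul_truncation_le_of_exp_le {a : EuclideanSpace ℝ (Fin n)} (ha : ‖a‖ = 1)
    {u v r : ℝ} (huv : u ≤ v) (hr : 0 < r) (hr2 : 2 / 3 ≤ r ^ 2)
    (hF : Real.exp (-r ^ 2) ≤ cubeProb (fun x => u < linForm a x)) :
    𝔼 x, linForm a x * truncation u v (linForm a x) ≤
      3 * (v - u) * r * cubeProb (fun x => u < linForm a x) := by
  classical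
  set F := cubeProb (fun x => u < linForm a x) with hFdef
  have h1 : 𝔼 x, truncation u v (linForm a x) ≤ (v - u) * F := by
    rw [hFdef, cubeProb_eq_expect, mul_expect]
    refine expect_le_expect fun x _ => ?_
    split_ifs with h
    · rw [mul_one]; exact truncation_le _
    · rw [truncation_of_le huv (not_lt.1 h)]; simp
  have h2 : r * 𝔼 x, linForm a x * truncation u v (linForm a x) ≤
      3 / 2 * r ^ 2 * 𝔼 x, truncation u v (linForm a x) +
        (v - u) * Real.exp (-(3 / 2 * r ^ 2)) * 𝔼 x, Real.exp (r * linForm a x) := by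
    rw [mul_expect, mul_expect, mul_expect, ← expect_add_distrib]
    refine expect_le_expect fun x _ => ?_
    have e1 := truncation_nonneg huv (linForm a x)
    have e2 := truncation_le (u := u) (v := v) (linForm a x)
    -- With `y = r * l - 3 / 2 * r ^ 2` this is `y * φ ≤ exp y * φ ≤ exp y * (v - u)`.
    have e3 := Real.add_one_le_exp (-(3 / 2 * r ^ 2) + r * linForm a x)
    have e4 := mul_le_mul_of_nonneg_right e3 e1
    have e5 := mul_le_mul_of_nonneg_left e2 (Real.exp_pos (-(3 / 2 * r ^ 2) + r * linForm a x)).le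
    have e6 : (v - u) * Real.exp (-(3 / 2 * r ^ 2)) * Real.exp (r * linForm a x) =
        Real.exp (-(3 / 2 * r ^ 2) + r * linForm a x) * (v - u) := by
      rw [Real.exp_add]; ring
    rw [e6]
    nlinarith
  have h3 : Real.exp (-(3 / 2 * r ^ 2)) * 𝔼 x, Real.exp (r * linForm a x) ≤ F := by
    refine le_trans (mul_le_mul_of_nonneg_left (expect_exp_linForm_le ha r) (Real.exp_pos _).le) ?_
    rw [← Real.exp_add]
    refine le_trans (le_of_eq ?_) hF
    congr 1; ring
  have hF0 : 0 ≤ F := cubeProb_nonneg _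
  have h4 : r * 𝔼 x, linForm a x * truncation u v (linForm a x) ≤
      r * (3 * (v - u) * r * F) := by
    calc _ ≤ _ := h2
      _ ≤ 3 / 2 * r ^ 2 * ((v - u) * F) + (v - u) * F := by
          rw [mul_assoc (v - u)]
          have := sub_nonneg.2 huv
          gcongr
      _ ≤ _ := by
          have : 0 ≤ (v - u) * F := mul_nonneg (sub_nonneg.2 huv) hF0
          nlinarith
  exact le_of_mul_le_mul_left h4 hr

/-! ### The two bounds -/

theorem cubeProb_tail_anti (a : EuclideanSpace ℝ (Fin n)) {s t : ℝ} (h : s ≤ t) :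
    cubeProb (fun x => t < linForm a x) ≤ cubeProb (fun x => s < linForm a x) :=
  cubeProb_mono fun _ hx => h.trans_lt hx

/-- By `cubeProb_tail_decay`, half of the mass above `t` lies within a distance `m + 4 / max 1 t`
of `t`. That range is covered by about `1 + 1 / (m * max 1 t)` intervals of length `2 m`, of which
the first is, up to a constant, the likeliest. -/
theorem tail_mul_min_le_cubeProb_Ioc {a : EuclideanSpace ℝ (Fin n)} (ha : ‖a‖ = 1) {m t : ℝ}
    (hm0 : 0 < m) (hm : ∀ i, |a i| ≤ m) (ht : -m ≤ t) :
    cubeProb (fun x => t < linForm a x) * min 1 (m * max 1 t) ≤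
      112 * cubeProb (fun x => linForm a x ∈ Set.Ioc t (t + 2 * m)) := by
  set p := cubeProb (fun x => linForm a x ∈ Set.Ioc t (t + 2 * m))
  have hp0 : 0 ≤ p := cubeProb_nonneg _
  set τ := max 1 t
  have hτ : 1 ≤ τ := le_max_left _ _
  have hτ0 : 0 < τ := by linarith
  set K := 4 / τ with hK
  have hK0 : 0 < K := by positivity
  have hKτ : K * τ = 4 := by rw [hK]; field_simp
  have hdist : 4 ≤ K * (max t 0 + K) := by
    rcases le_total t 1 with h | h
    · have : τ = 1 := max_eq_left h
      have hK4 : K = 4 := by rw [hK, this]; norm_num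
      rw [hK4]
      linarith [le_max_right t 0]
    · have : τ = t := max_eq_right h
      rw [mul_add, max_eq_left (by linarith : (0 : ℝ) ≤ t), ← this, hKτ]
      nlinarith
  have hhalf : 2 * cubeProb (fun x => max t 0 + K < linForm a x) ≤
      cubeProb (fun x => t < linForm a x) := by
    have h1 := cubeProb_tail_decay ha (le_max_right t 0) hK0.le
    have h2 := cubeProb_tail_anti a (le_max_left t 0)
    have h3 := mul_le_mul_of_nonneg_right hdist
      (cubeProb_nonneg fun x => max t 0 + K < linForm a x)
    linarith
  set N := ⌈(m + K) / (2 * m)⌉₊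
  have hN1 : m + K ≤ N * (2 * m) := by
    rw [← div_le_iff₀ (by positivity)]
    exact Nat.le_ceil _
  have hN2 : (N : ℝ) ≤ (m + K) / (2 * m) + 1 := (Nat.ceil_lt_add_one (by positivity)).le
  have hmax : max t 0 + K ≤ t + N * (2 * m) := by
    have : max t 0 ≤ t + m := max_le (by linarith) (by linarith)
    linarith
  have h1 := cubeProb_tail_sub_le hm0 hm ht N
  have h2 := cubeProb_tail_anti a hmax
  have h3 : cubeProb (fun x => t < linForm a x) ≤ 32 * N * p := by
    change _ ≤ (N : ℝ) * (16 * p) at h1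
    linarith
  have hmin0 : 0 ≤ min 1 (m * τ) := by positivity
  have h4 : 32 * (N : ℝ) * min 1 (m * τ) ≤ 112 := by
    have e1 : (m + K) / (2 * m) + 1 = 3 / 2 + 2 / (m * τ) := by
      rw [hK]; field_simp; ring
    rw [e1] at hN2
    have e2 : 2 / (m * τ) * min 1 (m * τ) ≤ 2 := by
      calc _ ≤ 2 / (m * τ) * (m * τ) := by gcongr; exact min_le_right _ _
        _ = 2 := by field_simp
    have e3 := min_le_left 1 (m * τ)
    have e4 := mul_le_mul_of_nonneg_right hN2 hmin0
    linarith
  calc _ ≤ 32 * N * p * min 1 (m * τ) := by gcongr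
    _ = 32 * N * min 1 (m * τ) * p := by ring
    _ ≤ _ := by gcongr

/-- The interval is compared with the tail at `t - 2 m` by means of the covariance of `l` with its
truncation to `[t - 2 m, t + 4 m]`. That tail is in turn at most twice the tail at `t`, because the
same comparison holds at every `s ≤ t`. -/
theorem cubeProb_Ioc_le_of_exp_le {a : EuclideanSpace ℝ (Fin n)} (ha : ‖a‖ = 1) {m t r : ℝ}
    (hm0 : 0 < m) (hm : ∀ i, |a i| ≤ m) (hr : 0 < r) (hr2 : 2 / 3 ≤ r ^ 2)
    (hF : Real.exp (-r ^ 2) ≤ cubeProb (fun x => t < linForm a x)) (hmr : 72 * (m * r) ≤ 1) :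
    cubeProb (fun x => linForm a x ∈ Set.Ioc t (t + 2 * m)) ≤
      36 * (m * r) * cubeProb (fun x => t < linForm a x) := by
  have hstep : ∀ s ≤ t, cubeProb (fun x => linForm a x ∈ Set.Ioc s (s + 2 * m)) ≤
      18 * (m * r) * cubeProb (fun x => s - 2 * m < linForm a x) := by
    intro s hs
    have h1 := cubeProb_Ioc_le_expect ha hm (s - 2 * m) (s + 4 * m)
    have h2 := expect_linForm_mul_truncation_le_of_exp_le ha (u := s - 2 * m) (v := s + 4 * m)
      (by linarith) hr hr2 (hF.trans (cubeProb_tail_anti a (by linarith)))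
    rw [show s - 2 * m + 2 * m = s by ring, show s + 4 * m - 2 * m = s + 2 * m by ring] at h1
    refine (h1.trans h2).trans_eq ?_
    ring
  let f : ℕ → ℝ := fun k => cubeProb (fun x => t - k * (2 * m) < linForm a x)
  have hf0 : f 0 = cubeProb (fun x => t < linForm a x) := by simp [f]
  have hfpos : 0 < f 0 := by rw [hf0]; exact (Real.exp_pos _).trans_le hF
  have hfstep : ∀ k, f (k + 1) - f k ≤ f (k + 2) / 4 := by
    intro k
    have h := hstep (t - (k + 1 : ℕ) * (2 * m)) (by
      have : 0 ≤ ((k + 1 : ℕ) : ℝ) * (2 * m) := by positivity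
      linarith)
    rw [cubeProb_Ioc a (by linarith),
      show t - (k + 1 : ℕ) * (2 * m) + 2 * m = t - k * (2 * m) by push_cast; ring,
      show t - (k + 1 : ℕ) * (2 * m) - 2 * m = t - (k + 2 : ℕ) * (2 * m) by push_cast; ring] at h
    have h0 : 0 ≤ f (k + 2) := cubeProb_nonneg _
    change f (k + 1) - f k ≤ 18 * (m * r) * f (k + 2) at h
    nlinarith
  -- If the tail more than doubled in one step to the left, it would do so in all further steps.
  have hdouble : f 1 ≤ 2 * f 0 := by
    by_contra! hcon
    have hind : ∀ k, 2 * f k < f (k + 1) := by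
      intro k
      induction k with
      | zero => simpa using hcon
      | succ k ih => linarith [hfstep k]
    have hpow : ∀ k, 2 ^ k * f 0 ≤ f k := by
      intro k
      induction k with
      | zero => simp
      | succ k ih => rw [pow_succ]; linarith [hind k]
    obtain ⟨k, hk⟩ := pow_unbounded_of_one_lt (1 / f 0) (one_lt_two : (1 : ℝ) < 2)
    rw [div_lt_iff₀ hfpos] at hk
    have : f k ≤ 1 := cubeProb_le_one _
    linarith [hpow k]
  have h := hstep t le_rfl
  have hf1 : f 1 = cubeProb (fun x => t - 2 * m < linForm a x) := by simp [f]
  rw [← hf1] at h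
  rw [← hf0]
  have : 0 < m * r := by positivity
  nlinarith

theorem mainTheorem12 :
    ∃ c C : ℝ, 0 < c ∧ 0 < C ∧
      ∀ (n : ℕ) (a : EuclideanSpace ℝ (Fin n)) (m t ε : ℝ),
        ‖a‖ = 1 →
        (∀ i, |a i| ≤ m) →
        -m ≤ t →
        ε = min (1 / 2) (cubeProb fun x => t < linForm a x) →
        c * (ε * min 1 (m * √(Real.log (1 / ε)))) ≤
            cubeProb (fun x => linForm a x ∈ Set.Ioc t (t + 2 * m)) ∧
          cubeProb (fun x => linForm a x ∈ Set.Ioc t (t + 2 * m)) ≤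
            C * (ε * min 1 (m * √(Real.log (1 / ε)))) := by
  refine ⟨1 / 1120, 144, by norm_num, by norm_num, fun n a m t ε ha hm ht hε => ?_⟩
  have hm0 : 0 < m := by
    by_contra! h
    have h0 : ∑ i, a i ^ 2 = 0 := sum_eq_zero fun i _ => by
      rw [abs_nonpos_iff.1 ((hm i).trans h)]; norm_num
    rw [sum_sq_eq_one ha] at h0
    exact one_ne_zero h0
  set F := cubeProb (fun x => t < linForm a x) with hFdef
  set p := cubeProb (fun x => linForm a x ∈ Set.Ioc t (t + 2 * m)) with hpdef
  have hF0 : 0 ≤ F := cubeProb_nonneg _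
  have hF1 : F ≤ 1 := cubeProb_le_one _
  have hp0 : 0 ≤ p := cubeProb_nonneg _
  have hpF : p ≤ F := cubeProb_mono fun x hx => hx.1
  have hε0 : 0 ≤ ε := by rw [hε]; positivity
  have hεF : ε ≤ F := by rw [hε]; exact min_le_right _ _
  have hε2 : ε ≤ 1 / 2 := by rw [hε]; exact min_le_left _ _
  have hFε : F ≤ 2 * ε := by
    rcases min_choice (1 / 2) F with h | h <;> rw [hε, h] <;> linarith
  set r := √(Real.log (1 / ε)) with hr
  have hr0 : 0 ≤ r := Real.sqrt_nonneg _
  constructor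
  · have hlow := tail_mul_min_le_cubeProb_Ioc ha hm0 hm ht
    have hτ : 1 ≤ max 1 t := le_max_left _ _
    set τ := max 1 t with hτdef
    -- Either `m * τ` is bounded below, or the Gaussian lower bound for the tail gives `r ≤ 10 * τ`.
    have hmin : min 1 (m * r) ≤ 10 * min 1 (m * τ) := by
      by_cases h : 8 * τ * m ≤ 1
      · have htail : Real.exp (-(98 * τ ^ 2)) ≤ ε := by
          rw [hε]
          refine le_min ?_ ((exp_le_cubeProb_tail ha hm hτ h).trans
            (cubeProb_tail_anti a (le_max_right _ _)))
          rw [Real.exp_neg, one_div]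
          refine inv_anti₀ (by norm_num) ?_
          have := Real.add_one_le_exp (98 * τ ^ 2)
          nlinarith
        have hrτ : r ≤ 10 * τ := by
          rw [hr]
          refine Real.sqrt_le_iff.2 ⟨by positivity, ?_⟩
          rw [one_div, Real.log_inv]
          have := (Real.le_log_iff_exp_le ((Real.exp_pos _).trans_le htail)).2 htail
          nlinarith
        have hmr : m * r ≤ 10 * (m * τ) := by nlinarith
        rw [mul_min_of_nonneg _ _ (by norm_num)]
        exact min_le_min (by norm_num) hmr
      · have : 1 / 10 ≤ min 1 (m * τ) := le_min (by norm_num) (by nlinarith)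
        linarith [min_le_left 1 (m * r)]
    have hmin0 : 0 ≤ min 1 (m * τ) := by positivity
    have h1 : ε * min 1 (m * r) ≤ F * (10 * min 1 (m * τ)) := by gcongr
    change F * min 1 (m * τ) ≤ 112 * p at hlow
    linarith
  · -- For `ε = 0` both sides vanish, whatever the value of `log (1 / 0)`.
    rcases hε0.eq_or_lt with h0 | hεpos
    · rw [← h0] at hFε ⊢
      linarith
    have hlog : Real.log 2 ≤ Real.log (1 / ε) := by
      refine Real.log_le_log (by norm_num) ?_
      rw [le_div_iff₀ hεpos]; linarith
    have hlog2 := Real.log_two_gt_d9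
    have hrsq : r ^ 2 = Real.log (1 / ε) := Real.sq_sqrt (by linarith)
    have hrpos : 0 < r := Real.sqrt_pos.2 (by linarith)
    by_cases h : 72 * (m * r) ≤ 1
    · have hexp : Real.exp (-r ^ 2) ≤ F := by
        rw [hrsq, one_div, Real.log_inv, neg_neg, Real.exp_log hεpos]
        exact hεF
      have hup := cubeProb_Ioc_le_of_exp_le ha hm0 hm hrpos (by rw [hrsq]; linarith) hexp h
      change p ≤ 36 * (m * r) * F at hup
      have hmr : 0 < m * r := by positivity
      rw [min_eq_right (by linarith)]
      nlinarith
    · have : 1 / 72 ≤ min 1 (m * r) := le_min (by norm_num) (by linarith)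
      nlinarith
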